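/- Fix $n$ states $\omega_1,\dots,\omega_n$, ordered by index. A finite experiment is an $n\times m$ row-stochastic matrix $f=[f^1,\dots,f^m]$, $2\le m<\infty$, where $f^j_i$ is the probability of signal $j$ in state $i$; let $\mathcal E$ be the set of all finite experiments (over all $m\ge 2$). For $f\in\mathcal E$ with $m$ signals and $g\in\mathcal E$ with $m'$ signals: - $f\succeq_B g$ (Blackwell) if $g=fM$ for some $m\times m'$ stochastic matrix $M$. A cost $C:\mathcal E\to\mathbb R_+$ is Blackwell monotone if $f\succeq_B g$ implies $C(f)\ge C(g)$. - $f$ satisfies the MLRP if $f^j_i f^{j'}_{i'}\ge f^j_{i'}f^{j'}_i$ for all $i<i'$ and $j<j'$. Let $\tilde F(\cdot|\omega_i)$ be the piecewise linear distribution function on $[0,m]$ that spreads the mass $f^j_i$ uniformly over $[j-1,j]$, and let $\tilde G$ be obtained from $g$ in the same way. For MLRP experiments, $f\succeq_L g$ (Lehmann) if for every $y\in[0,m']$ the inverse $\tilde F^{-1}(\tilde G(y|\omega_i)|\omega_i)$ is nondecreasing in $i$; where $\tilde F(\cdot|\omega_i)$ is not injective, this means that there are $x_1\le\dots\le x_n$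 in $[0,m]$ with $\tilde F(x_i|\omega_i)=\tilde G(y|\omega_i)$ for all $i$. $C$ is Lehmann monotone if $C(f)\ge C(g)$ for all MLRP experiments $f,g$ with $f\succeq_L g$. Let $C:\mathcal E\to\mathbb R_+$ be likelihood separable, that is, $C(f)=\sum_{j=1}^m\psi(f^j)-\psi(\mathbf 1)$ for all $m$ and all $f\in\mathcal E$ with $m$ signals, where $\psi:[0,1]^n\to\mathbb R_+$ is differentiable at every point of $[0,1]^n\setminus\{0\}$ (relative to the cube, so partial derivatives are one-sided at the boundary). Call $\psi$ sublinear if $\psi(\gamma h)=\gamma\psi(h)$ whenever $h\in[0,1]^n$, $\gamma\ge0$, $\gamma h\in[0,1]^n$, and $\psi(h+h')\le\psi(h)+\psi(h')$ whenever $h,h',h+h'\in[0,1]^n$. Then: (i) $C$ is Blackwell monotone if and only if $\psi$ is sublinear. (ii) If $\psi$ is sublinear, then $C$ is Lehmann monotone provided that, for all $l\in\{1,\dots,n\}$, $$\sum_{i=1}^{l}\Big(-\frac{\partial\psi(h)}{\partial h_i}+\frac{\partial\psi(h')}{\partial h'_i}\Big)h_i\le 0\quad\text{and}\quad \sum_{i=l}^{n}\Big(-\frac{\partial\psi(h')}{\partial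 h'_i}+\frac{\partial\psi(h)}{\partial h_i}\Big)h'_i\le 0$$ for all nonzero $h,h'\in[0,1]^n$ with $h\le_{MLRP}h'$, i.e. $h_ih'_{i'}\ge h_{i'}h'_i$ for all $i<i'$. -/

import Mathlib

open scoped NNReal

/-- A rectangular (row-)stochastic matrix: nonnegative entries, every row sums to one. -/
def IsStochasticMatrix {a b : ℕ} (M : Matrix (Fin a) (Fin b) ℝ) : Prop :=
  (∀ i j, 0 ≤ M i j) ∧ ∀ i, ∑ j, M i j = 1

/-- A finite experiment on `n` states: a number `m ≥ 2` of signals and the `n × m` stochastic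
matrix whose `(i, j)` entry is the probability of signal `j` in state `i`. -/
structure FiniteExperiment (n : ℕ) where
  m : ℕ
  two_le : 2 ≤ m
  mat : Matrix (Fin n) (Fin m) ℝ
  stochastic : IsStochasticMatrix mat

namespace FiniteExperiment

variable {n : ℕ}

/-- The likelihood vector (column) of signal `j`. -/
def col (f : FiniteExperiment n) (j : Fin f.m) : Fin n → ℝ := fun i => f.mat i j

/-- `f` is Blackwell more informative than `g`: `g = f M` for some stochastic matrix `M`. -/
def BlackwellGE (f g : FiniteExperiment n) : Prop :=
  ∃ M : Matrix (Fin f.m) (Fin g.m) ℝ, IsStochasticMatrix M ∧ g.mat = f.mat * M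

/-- The monotone likelihood ratio property. -/
def MLRP (f : FiniteExperiment n) : Prop :=
  ∀ i i' : Fin n, i < i' → ∀ j j' : Fin f.m, j < j' →
    f.mat i' j * f.mat i j' ≤ f.mat i j * f.mat i' j'

/-- The cumulative distribution function, given state `i`, of the continuous experiment on
`[0, m]` in which signal `j` (counted from `0`) is spread uniformly over `[j, j + 1]`. -/
noncomputable def cdf (f : FiniteExperiment n) (i : Fin n) (x : ℝ) : ℝ :=
  ∑ j : Fin f.m, f.mat i j * max 0 (min 1 (x - (j : ℝ)))

/-- `f` is Lehmann more informative than `g`: for every `y ∈ [0, m']`, the inverse of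
`f.cdf i` at `g.cdf i y` is nondecreasing in the state `i`. As `f.cdf i` is constant on the
intervals of signals that have probability zero in state `i`, its inverse can be set-valued;
it is nondecreasing in `i` if one can select from it nondecreasingly. When every `f.cdf i` is
strictly increasing on `[0, m]`, the selection is the inverse function itself. -/
def LehmannGE (f g : FiniteExperiment n) : Prop :=
  ∀ y ∈ Set.Icc (0 : ℝ) g.m, ∃ x : Fin n → ℝ, Monotone x ∧
    ∀ i, x i ∈ Set.Icc (0 : ℝ) f.m ∧ f.cdf i (x i) = g.cdf i y

end FiniteExperiment

/-- A cost is Blackwell monotone if more informative experiments cost at least as much. -/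
def BlackwellMonotone {n : ℕ} (C : FiniteExperiment n → ℝ≥0) : Prop :=
  ∀ f g : FiniteExperiment n, f.BlackwellGE g → C g ≤ C f

/-- A cost is Lehmann monotone if, among experiments with the monotone likelihood ratio
property, Lehmann more informative ones cost at least as much. -/
def LehmannMonotone {n : ℕ} (C : FiniteExperiment n → ℝ≥0) : Prop :=
  ∀ f g : FiniteExperiment n, f.MLRP → g.MLRP → f.LehmannGE g → C g ≤ C f

/-- The cube `[0, 1]ⁿ`. -/
def unitCube (n : ℕ) : Set (Fin n → ℝ) := Set.Icc 0 1

/-- `C(f) = ∑ⱼ ψ(fʲ) - ψ(1)` for a function `ψ : [0, 1]ⁿ → ℝ₊`, differentiable (relative to the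
cube) at every point other than the origin. Only the values of `ψ` on the cube matter. -/
structure IsLikelihoodSeparable {n : ℕ} (C : FiniteExperiment n → ℝ≥0)
    (ψ : (Fin n → ℝ) → ℝ) : Prop where
  nonneg : ∀ h ∈ unitCube n, 0 ≤ ψ h
  differentiable : ∀ h ∈ unitCube n, h ≠ 0 → DifferentiableWithinAt ℝ ψ (unitCube n) h
  cost_eq : ∀ f : FiniteExperiment n, (C f : ℝ) = ∑ j, ψ (f.col j) - ψ 1

/-- Sublinearity of a function on the cube: positive homogeneity and subadditivity. -/
def SublinearOnCube {n : ℕ} (ψ : (Fin n → ℝ) → ℝ) : Prop :=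
  (∀ h ∈ unitCube n, ∀ γ : ℝ, 0 ≤ γ → γ • h ∈ unitCube n → ψ (γ • h) = γ * ψ h) ∧
  ∀ h ∈ unitCube n, ∀ h' ∈ unitCube n, h + h' ∈ unitCube n → ψ (h + h') ≤ ψ h + ψ h'

/-- The monotone likelihood ratio comparison `h ≤ h'` of two likelihood vectors. -/
def MLRPLE {n : ℕ} (h h' : Fin n → ℝ) : Prop :=
  ∀ i i' : Fin n, i < i' → h i' * h' i ≤ h i * h' i'

/-- The partial derivative `∂ψ/∂hᵢ` at a point of the cube (one-sided on its boundary). -/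
noncomputable def cubePartial {n : ℕ} (ψ : (Fin n → ℝ) → ℝ) (i : Fin n) (h : Fin n → ℝ) : ℝ :=
  fderivWithin ℝ ψ (unitCube n) h (Pi.single i 1)

/-! Blackwell part. A garbling replaces the likelihood vectors of `f` by nonnegative combinations
with row weights summing to one, so sublinearity bounds the cost. Conversely, merging two signals
gives subadditivity. Splitting a signal into proportional pieces is Blackwell neutral, so `ψ` is
additive along rays; being nonnegative, it is then linear along them
(`eq_zero_of_doubling_of_reflection`).

Lehmann part. Suppose first that all entries are positive. For each state `q`, couple the signals of
`g` and `f` along the quantiles of state `q`, and give a matched pair the vector following `g` below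
`q` and `f` from `q` on. By homogeneity the cost of this hybrid is that of `f` at the lowest state
and that of `g` at the highest, so it suffices that it falls when `q` moves up one state
(`hybridCost_succ_le`). A supporting hyperplane at the upper hybrid splits the cost into a part `L`
carried by the states of `g` and a part `U` carried by those of `f`. The derivative conditions make
`L` fall in the signal of `f` and `U` rise in the signal of `g`. Lehmann's order moves the
`f`-signal matched with a given `g`-signal up, and the `g`-signal matched with a given `f`-signal
down, so both parts fall.

In general, null signals are dropped and the states are mixed by a positive, totally positive
matrix. This yields positive entries, preserves the MLRP, and makes the crossing condition robust to
ties (`isSingleCrossing_mulVec`). Letting the mixing tend to the identity, continuity of `ψ` away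
from the origin finishes the proof. -/

/-! ### Telescoping and Abel summation over finite linear orders -/

section LinearOrderSums

variable {K : Type*} [LinearOrder K]

/-- In increasing order of `k`, the summands are successive increments of `Φ` along the partial sums
of `a`. -/
theorem sum_telescope_finset (s : Finset K) (a : K → ℝ) (Φ : ℝ → ℝ) :
    ∑ k ∈ s, (Φ (∑ k' ∈ s with k' < k, a k' + a k) - Φ (∑ k' ∈ s with k' < k, a k')) =
      Φ (∑ k ∈ s, a k) - Φ 0 := by
  induction s using Finset.induction_on_max with
  | empty => simp
  | insert x s hx ih =>
    have hxs : x ∉ s := fun h => lt_irrefl _ (hx x h)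
    have h1 : Finset.filter (fun k' => k' < x) (insert x s) = s := by
      ext z
      simp only [Finset.mem_filter, Finset.mem_insert]
      constructor
      · rintro ⟨rfl | h, h'⟩
        · exact absurd h' (lt_irrefl _)
        · exact h
      · exact fun h => ⟨Or.inr h, hx z h⟩
    have h2 : ∀ k ∈ s, Finset.filter (fun k' => k' < k) (insert x s) =
        Finset.filter (fun k' => k' < k) s := by
      intro k hk
      rw [Finset.filter_insert, if_neg (not_lt.2 (hx k hk).le)]
    have h3 : ∑ k ∈ s, (Φ (∑ k' ∈ insert x s with k' < k, a k' + a k) -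
        Φ (∑ k' ∈ insert x s with k' < k, a k')) = Φ (∑ k ∈ s, a k) - Φ 0 := by
      rw [← ih]
      exact Finset.sum_congr rfl fun k hk => by rw [h2 k hk]
    rw [Finset.sum_insert hxs, Finset.sum_insert hxs, h1, h3, add_comm (a x)]
    ring

/-- Abel summation: nonnegative partial sums against an antitone weight. -/
theorem mul_sum_le_sum_mul_of_antitone (s : Finset K) (d φ : K → ℝ) (hφ : Antitone φ)
    (hd : ∀ κ ∈ s, 0 ≤ ∑ k ∈ s with k ≤ κ, d k) (c : ℝ) (hc : ∀ k ∈ s, c ≤ φ k) :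
    c * ∑ k ∈ s, d k ≤ ∑ k ∈ s, d k * φ k := by
  induction s using Finset.induction_on_max generalizing c with
  | empty => simp
  | insert x s hx ih =>
    have hxs : x ∉ s := fun h => lt_irrefl _ (hx x h)
    have htot : 0 ≤ ∑ k ∈ insert x s, d k := by
      have := hd x (Finset.mem_insert_self _ _)
      rwa [Finset.filter_true_of_mem] at this
      intro k hk
      rcases Finset.mem_insert.1 hk with rfl | h
      · exact le_rfl
      · exact (hx k h).le
    have h2 : ∀ κ ∈ s, 0 ≤ ∑ k ∈ s with k ≤ κ, d k := by
      intro κ hκ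
      have := hd κ (Finset.mem_insert_of_mem hκ)
      rwa [Finset.filter_insert, if_neg (not_le.2 (hx κ hκ))] at this
    -- The lower bound is raised from `c` to `φ x`, the least weight; this is why `c` is generalized
    -- in the induction.
    have h3 := ih h2 (φ x) (fun k hk => hφ (hx k hk).le)
    calc c * ∑ k ∈ insert x s, d k ≤ φ x * ∑ k ∈ insert x s, d k :=
          mul_le_mul_of_nonneg_right (hc x (Finset.mem_insert_self _ _)) htot
      _ = d x * φ x + φ x * ∑ k ∈ s, d k := by rw [Finset.sum_insert hxs]; ring
      _ ≤ _ := by rw [Finset.sum_insert hxs]; linarith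

variable [Fintype K]

/-- First-order stochastic dominance: `B` has its mass further up than `A`. It is Abel summation
applied to `A - B`, whose total is zero. -/
theorem sum_mul_le_sum_mul_of_antitone (A B φ : K → ℝ) (hφ : Antitone φ)
    (hAB : ∀ κ, ∑ k with k ≤ κ, B k ≤ ∑ k with k ≤ κ, A k) (htot : ∑ k, A k = ∑ k, B k) :
    ∑ k, B k * φ k ≤ ∑ k, A k * φ k := by
  obtain h | h := isEmpty_or_nonempty K
  · simp
  obtain ⟨c, hc⟩ : ∃ c, ∀ k, c ≤ φ k := by
    obtain ⟨k, hk⟩ := Finite.exists_min φ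
    exact ⟨_, hk⟩
  have := mul_sum_le_sum_mul_of_antitone Finset.univ (fun k => A k - B k) φ hφ
    (fun κ _ => by rw [Finset.sum_sub_distrib]; linarith [hAB κ]) c (fun k _ => hc k)
  simp only [sub_mul, Finset.sum_sub_distrib] at this
  rw [htot] at this
  linarith

/-- The mass strictly below `k`, plus the fraction `s` of the mass at `k`. -/
def cumul (a : K → ℝ) (k : K) (s : ℝ) : ℝ := ∑ k' with k' < k, a k' + s * a k

theorem cumul_one_sub_telescope (a : K → ℝ) (Φ : ℝ → ℝ) (κ : K) :
    ∑ k with k ≤ κ, (Φ (cumul a k 1) - Φ (cumul a k 0)) = Φ (cumul a κ 1) - Φ 0 := by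
  have h := sum_telescope_finset (Finset.univ.filter (· ≤ κ)) a Φ
  have h2 : ∀ k ∈ Finset.univ.filter (· ≤ κ), Finset.filter (fun k' => k' < k)
      (Finset.univ.filter (· ≤ κ)) = Finset.univ.filter (· < k) := by
    intro k hk
    ext z
    simp only [Finset.mem_filter, Finset.mem_univ, true_and] at hk ⊢
    exact ⟨fun h => h.2, fun h => ⟨h.le.trans hk, h⟩⟩
  have h4 : ∑ k with k ≤ κ, (Φ (cumul a k 1) - Φ (cumul a k 0)) =
      Φ (∑ k with k ≤ κ, a k) - Φ 0 := by
    rw [← h]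
    exact Finset.sum_congr rfl fun k hk => by rw [h2 k hk]; simp [cumul]
  have h3 : ∑ k with k ≤ κ, a k = cumul a κ 1 := by
    have : (Finset.univ.filter (· ≤ κ)) = insert κ (Finset.univ.filter (· < κ)) := by
      ext z
      simp only [Finset.mem_filter, Finset.mem_univ, true_and, Finset.mem_insert]
      exact le_iff_eq_or_lt
    rw [this, Finset.sum_insert (by simp), cumul]
    ring
  rw [h4, h3]

theorem sum_cumul_telescope (a : K → ℝ) (Φ : ℝ → ℝ) :
    ∑ k, (Φ (cumul a k 1) - Φ (cumul a k 0)) = Φ (∑ k, a k) - Φ 0 := by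
  simpa [cumul] using sum_telescope_finset Finset.univ a Φ

theorem cumul_zero_nonneg {a : K → ℝ} (ha : ∀ k, 0 ≤ a k) (k : K) : 0 ≤ cumul a k 0 := by
  simp only [cumul, zero_mul, add_zero]
  exact Finset.sum_nonneg fun k _ => ha k

theorem cumul_eq_zero_add (a : K → ℝ) (k : K) (s : ℝ) : cumul a k s = cumul a k 0 + s * a k := by
  simp [cumul]

theorem cumul_one_le_sum {a : K → ℝ} (ha : ∀ k, 0 ≤ a k) (k : K) : cumul a k 1 ≤ ∑ k, a k := by
  have : ∑ k' ∈ insert k (Finset.univ.filter (· < k)), a k' ≤ ∑ k, a k :=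
    Finset.sum_le_sum_of_subset_of_nonneg (Finset.subset_univ _) fun k _ _ => ha k
  rw [Finset.sum_insert (by simp)] at this
  rw [cumul]
  linarith

end LinearOrderSums

/-! ### The comonotone coupling -/

section Coupling

variable {J K : Type*} [LinearOrder J] [LinearOrder K] [Fintype J] [Fintype K]

/-- The comonotone coupling of two finite mass distributions on linearly ordered sets. -/
noncomputable def comonotoneCoupling (b : J → ℝ) (a : K → ℝ) (j : J) (k : K) : ℝ :=
  (min (cumul b j 1) (cumul a k 1) - min (cumul b j 0) (cumul a k 1)) -
    (min (cumul b j 1) (cumul a k 0) - min (cumul b j 0) (cumul a k 0))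

theorem comonotoneCoupling_comm (b : J → ℝ) (a : K → ℝ) (j : J) (k : K) :
    comonotoneCoupling b a j k = comonotoneCoupling a b k j := by
  simp only [comonotoneCoupling, min_comm]
  ring

/-- The coupling is the mixed second difference of `min`, that is, the length of the overlap of the
quantile intervals of `j` and `k`. -/
theorem comonotoneCoupling_nonneg {b : J → ℝ} {a : K → ℝ} (hb : ∀ j, 0 ≤ b j) (ha : ∀ k, 0 ≤ a k)
    (j : J) (k : K) : 0 ≤ comonotoneCoupling b a j k := by
  have h1 := cumul_eq_zero_add b j 1
  have h2 := cumul_eq_zero_add a k 1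
  have := hb j
  have := ha k
  simp only [comonotoneCoupling]
  rcases min_cases (cumul b j 1) (cumul a k 1) with h3 | h3 <;>
  rcases min_cases (cumul b j 0) (cumul a k 1) with h4 | h4 <;>
  rcases min_cases (cumul b j 1) (cumul a k 0) with h5 | h5 <;>
  rcases min_cases (cumul b j 0) (cumul a k 0) with h6 | h6 <;> linarith

theorem sum_le_comonotoneCoupling {b : J → ℝ} {a : K → ℝ} (hb : ∀ j, 0 ≤ b j)
    (j : J) (κ : K) : ∑ k with k ≤ κ, comonotoneCoupling b a j k =
      min (cumul b j 1) (cumul a κ 1) - min (cumul b j 0) (cumul a κ 1) := by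
  have := cumul_one_sub_telescope a (fun x => min (cumul b j 1) x - min (cumul b j 0) x) κ
  have h0 := cumul_zero_nonneg hb j
  have h1 : 0 ≤ cumul b j 1 := by rw [cumul_eq_zero_add]; linarith [hb j]
  simp only [min_eq_right h0, min_eq_right h1] at this
  simpa [comonotoneCoupling] using this

theorem sum_comonotoneCoupling {b : J → ℝ} {a : K → ℝ} (hb : ∀ j, 0 ≤ b j)
    (hab : ∑ j, b j = ∑ k, a k) (j : J) : ∑ k, comonotoneCoupling b a j k = b j := by
  have := sum_cumul_telescope a (fun x => min (cumul b j 1) x - min (cumul b j 0) x)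
  have h0 := cumul_zero_nonneg hb j
  have h2 := cumul_one_le_sum hb j
  have h3 := cumul_eq_zero_add b j 1
  have h1 : 0 ≤ cumul b j 1 := by linarith [hb j]
  rw [← hab] at this
  simp only [min_eq_right h0, min_eq_right h1, min_eq_left h2,
    min_eq_left (show cumul b j 0 ≤ ∑ j, b j by linarith [hb j])] at this
  simp only [comonotoneCoupling]
  linarith

/-- Each side is the share of an interval (`[G, G + g]` or its primed version) lying below the
threshold. It turns single crossing into dominance of the conditional matching laws. -/
theorem min_sub_min_div_le {c G g c' G' g' : ℝ} (hg : 0 < g) (hg' : 0 < g')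
    (h : ∀ t ∈ Set.Icc (0 : ℝ) 1, c ≤ G + t * g → c' ≤ G' + t * g') :
    (min (G' + 1 * g') c' - min G' c') / g' ≤ (min (G + 1 * g) c - min G c) / g := by
  -- The share itself is the position at which `h` is tested. If `c` lies beyond the interval, then
  -- `t = 1` and the bound is trivial.
  set t := (min (G + 1 * g) c - min G c) / g with ht
  have hgt : t * g = min (G + 1 * g) c - min G c := by rw [ht]; field_simp
  rw [div_le_iff₀ hg']
  have ht0 : 0 ≤ t := by
    apply div_nonneg _ hg.le
    have := min_le_min_right c (show G ≤ G + 1 * g by linarith)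
    linarith
  by_cases hc : c ≤ G + 1 * g
  · rw [min_eq_right hc] at hgt
    have h1 : c ≤ G + t * g := by rw [hgt]; linarith [min_le_left G c]
    have h2 : t ≤ 1 := by
      rw [← mul_le_mul_iff_of_pos_right hg, hgt]
      rcases min_cases G c with h | h <;> linarith
    have h3 := h t ⟨ht0, h2⟩ h1
    have h4 : 0 ≤ t * g' := mul_nonneg ht0 hg'.le
    have h5 := min_le_right (G' + 1 * g') c'
    rcases min_cases G' c' with h | h <;> linarith
  · push Not at hc
    rw [min_eq_left hc.le, min_eq_left (by linarith)] at hgt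
    have : t = 1 := by
      have : t * g = 1 * g := by linarith
      exact mul_right_cancel₀ hg.ne' this
    rw [this]
    rcases min_cases G' c' with h | h <;> rcases min_cases (G' + 1 * g') c' with h' | h' <;> linarith

theorem div_le_min_sub_min {c G g c' G' g' : ℝ} (hg : 0 < g) (hg' : 0 < g')
    (h : ∀ t ∈ Set.Icc (0 : ℝ) 1, G + t * g ≤ c → G' + t * g' ≤ c') :
    (min (G + 1 * g) c - min G c) / g ≤ (min (G' + 1 * g') c' - min G' c') / g' := by
  set t := (min (G + 1 * g) c - min G c) / g with ht
  have hgt : t * g = min (G + 1 * g) c - min G c := by rw [ht]; field_simp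
  rw [le_div_iff₀ hg']
  have ht1 : t ≤ 1 := by
    rw [← mul_le_mul_iff_of_pos_right hg, hgt]
    rcases min_cases G c with h | h <;> rcases min_cases (G + 1 * g) c with h' | h' <;> linarith
  by_cases hc : G ≤ c
  · rw [min_eq_left hc] at hgt
    have h1 : G + t * g ≤ c := by rw [hgt]; linarith [min_le_right (G + 1 * g) c]
    have h2 : 0 ≤ t := by
      rw [← mul_le_mul_iff_of_pos_right hg, hgt]
      rcases min_cases (G + 1 * g) c with h | h <;> linarith
    have h3 := h t ⟨h2, ht1⟩ h1
    have h4 : 0 ≤ t * g' := mul_nonneg h2 hg'.le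
    have h6 : t * g' ≤ 1 * g' := mul_le_mul_of_nonneg_right ht1 hg'.le
    rcases min_cases G' c' with h | h <;> rcases min_cases (G' + 1 * g') c' with h' | h' <;> linarith
  · push Not at hc
    rw [min_eq_right hc.le, min_eq_right (by linarith)] at hgt
    have h0 : t * g' = 0 := by
      have : t * g = 0 := by linarith
      rcases mul_eq_zero.1 this with h | h
      · rw [h]; ring
      · linarith
    rw [h0]
    have := min_le_min_right c' (show G' ≤ G' + 1 * g' by linarith)
    linarith

end Coupling

/-! ### Hybrid experiments and the descent through the states -/

section Hybrid

variable {n : ℕ} {J K : Type*} [LinearOrder J] [LinearOrder K] [Fintype J] [Fintype K]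

/-- `∑ᵢ Pᵢ(h) aᵢ` is a supporting function of `Ψ` on the positive orthant which satisfies the
monotonicity conditions along the monotone likelihood ratio order. -/
structure IsMLRSupport (Ψ : (Fin n → ℝ) → ℝ) (P : Fin n → (Fin n → ℝ) → ℝ) : Prop where
  smul : ∀ (c : ℝ) (h : Fin n → ℝ), 0 < c → (∀ i, 0 < h i) → Ψ (c • h) = c * Ψ h
  euler : ∀ h : Fin n → ℝ, (∀ i, 0 < h i) → ∑ i, P i h * h i = Ψ h
  support : ∀ h a : Fin n → ℝ, (∀ i, 0 < h i) → (∀ i, 0 < a i) → ∑ i, P i h * a i ≤ Ψ a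
  lower : ∀ (l : Fin n) (h h' : Fin n → ℝ), (∀ i, 0 < h i) → (∀ i, 0 < h' i) → MLRPLE h h' →
    ∑ i ∈ Finset.Iic l, P i h' * h i ≤ ∑ i ∈ Finset.Iic l, P i h * h i
  upper : ∀ (l : Fin n) (h h' : Fin n → ℝ), (∀ i, 0 < h i) → (∀ i, 0 < h' i) → MLRPLE h h' →
    ∑ i ∈ Finset.Ici l, P i h * h' i ≤ ∑ i ∈ Finset.Ici l, P i h' * h' i

/-- The likelihood vector that follows `u` below state `q` and `v` from state `q` on. -/
noncomputable def hybrid (q : Fin n) (u v : Fin n → ℝ) : Fin n → ℝ :=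
  fun i => if i < q then u i / u q else v i / v q

theorem hybrid_pos (q : Fin n) {u v : Fin n → ℝ} (hu : ∀ i, 0 < u i) (hv : ∀ i, 0 < v i)
    (i : Fin n) : 0 < hybrid q u v i := by
  unfold hybrid
  split_ifs
  · exact div_pos (hu i) (hu q)
  · exact div_pos (hv i) (hv q)

theorem hybrid_of_le (q : Fin n) {u v : Fin n → ℝ} (hu : ∀ i, 0 < u i) (hv : ∀ i, 0 < v i)
    {i : Fin n} (hi : i ≤ q) : hybrid q u v i = u i / u q := by
  unfold hybrid
  split_ifs with h
  · rfl
  · obtain rfl : i = q := le_antisymm hi (not_lt.1 h)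
    rw [div_self (hu i).ne', div_self (hv i).ne']

theorem hybrid_of_ge (q : Fin n) (u v : Fin n → ℝ) {i : Fin n} (hi : q ≤ i) :
    hybrid q u v i = v i / v q := if_neg (not_lt.2 hi)

theorem MLRPLE.div_le_div_of_le {u u' : Fin n → ℝ} (h : MLRPLE u u') (hu : ∀ i, 0 < u i)
    (hu' : ∀ i, 0 < u' i) {q i : Fin n} (hi : q ≤ i) : u i / u q ≤ u' i / u' q := by
  rcases hi.eq_or_lt with rfl | hi
  · rw [div_self (hu _).ne', div_self (hu' _).ne']
  · rw [div_le_div_iff₀ (hu q) (hu' q)]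
    linarith [h q i hi]

theorem MLRPLE.div_le_div_of_ge {u u' : Fin n → ℝ} (h : MLRPLE u u') (hu : ∀ i, 0 < u i)
    (hu' : ∀ i, 0 < u' i) {q i : Fin n} (hi : i ≤ q) : u' i / u' q ≤ u i / u q := by
  rcases hi.eq_or_lt with rfl | hi
  · rw [div_self (hu _).ne', div_self (hu' _).ne']
  · rw [div_le_div_iff₀ (hu' q) (hu q)]
    linarith [h i q hi]

theorem MLRPLE.hybrid {u u' v v' : Fin n → ℝ} (hu : ∀ i, 0 < u i) (hu' : ∀ i, 0 < u' i)
    (hv : ∀ i, 0 < v i) (hv' : ∀ i, 0 < v' i) (huu : MLRPLE u u') (hvv : MLRPLE v v')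
    (q : Fin n) : MLRPLE (hybrid q u v) (hybrid q u' v') := by
  intro i i' hii
  rcases lt_or_ge i' q with h | h
  · rw [hybrid_of_le q hu hv h.le, hybrid_of_le q hu' hv' (hii.trans h).le,
      hybrid_of_le q hu hv (hii.trans h).le, hybrid_of_le q hu' hv' h.le,
      div_mul_div_comm, div_mul_div_comm]
    exact div_le_div_of_nonneg_right (huu i i' hii) (mul_pos (hu q) (hu' q)).le
  rcases lt_or_ge i q with h2 | h2
  · rw [hybrid_of_ge q u v h, hybrid_of_ge q u' v' h, hybrid_of_le q hu' hv' h2.le,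
      hybrid_of_le q hu hv h2.le, mul_comm]
    exact mul_le_mul (huu.div_le_div_of_ge hu hu' h2.le) (hvv.div_le_div_of_le hv hv' h)
      (div_pos (hv _) (hv _)).le (div_pos (hu _) (hu _)).le
  · rw [hybrid_of_ge q u v h, hybrid_of_ge q u' v' h, hybrid_of_ge q u v h2,
      hybrid_of_ge q u' v' h2, div_mul_div_comm, div_mul_div_comm]
    exact div_le_div_of_nonneg_right (hvv i i' hii) (mul_pos (hv q) (hv' q)).le

theorem MLRPLE.refl (u : Fin n → ℝ) : MLRPLE u u := fun i i' _ => by rw [mul_comm]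

/-- The cost of the experiment that follows `g` in the states below `q` and `f` from `q` on, the
two being matched along the quantiles of state `q`. -/
noncomputable def hybridCost (Ψ : (Fin n → ℝ) → ℝ) (f : K → Fin n → ℝ) (g : J → Fin n → ℝ)
    (q : Fin n) : ℝ :=
  ∑ j, ∑ k, comonotoneCoupling (g · q) (f · q) j k * Ψ (hybrid q (g j) (f k))

/-- Quantile matching of `f` with `g` is nondecreasing in the state. -/
def IsSingleCrossing (f : K → Fin n → ℝ) (g : J → Fin n → ℝ) : Prop :=
  ∀ i i' : Fin n, i < i' → ∀ k, ∀ s ∈ Set.Icc (0 : ℝ) 1, ∀ j, ∀ t ∈ Set.Icc (0 : ℝ) 1,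
    cumul (f · i) k s ≤ cumul (g · i) j t → cumul (f · i') k s ≤ cumul (g · i') j t

variable {f : K → Fin n → ℝ} {g : J → Fin n → ℝ} {Ψ : (Fin n → ℝ) → ℝ}
  {P : Fin n → (Fin n → ℝ) → ℝ}

/-- Dividing by `g j q` gives the law of the matched `f`-signal conditional on `j`; single crossing
shifts this law up as the state rises. -/
theorem sum_coupling_div_mul_antitone (hg : ∀ j i, 0 < g j i)
    (hfg : ∀ i, ∑ j, g j i = ∑ k, f k i) (hsc : IsSingleCrossing f g) {q q' : Fin n} (hq : q < q')
    (j : J) (φ : K → ℝ) (hφ : Antitone φ) :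
    ∑ k, comonotoneCoupling (g · q') (f · q') j k / g j q' * φ k ≤
      ∑ k, comonotoneCoupling (g · q) (f · q) j k / g j q * φ k := by
  apply sum_mul_le_sum_mul_of_antitone _ _ _ hφ
  · intro κ
    rw [← Finset.sum_div, ← Finset.sum_div, sum_le_comonotoneCoupling (fun j => (hg j _).le),
      sum_le_comonotoneCoupling (fun j => (hg j _).le), cumul_eq_zero_add (g · q) j 1,
      cumul_eq_zero_add (g · q') j 1]
    apply min_sub_min_div_le (hg _ _) (hg _ _)
    intro t ht h
    rw [← cumul_eq_zero_add (g · q') j t]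
    rw [← cumul_eq_zero_add (g · q) j t] at h
    exact hsc q q' hq κ 1 (by simp) j t ht h
  · rw [← Finset.sum_div, ← Finset.sum_div, sum_comonotoneCoupling (fun j => (hg j _).le) (hfg q),
      sum_comonotoneCoupling (fun j => (hg j _).le) (hfg q'), div_self (hg _ _).ne',
      div_self (hg _ _).ne']

/-- The mirror image: conditional on `k`, the law of the matched `g`-signal shifts down as the state
rises. -/
theorem sum_coupling_div_mul_monotone (hf : ∀ k i, 0 < f k i)
    (hfg : ∀ i, ∑ j, g j i = ∑ k, f k i) (hsc : IsSingleCrossing f g) {q q' : Fin n} (hq : q < q')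
    (k : K) (φ : J → ℝ) (hφ : Monotone φ) :
    ∑ j, comonotoneCoupling (g · q') (f · q') j k / f k q' * φ j ≤
      ∑ j, comonotoneCoupling (g · q) (f · q) j k / f k q * φ j := by
  simp only [comonotoneCoupling_comm (fun j => g j _)]
  have := sum_mul_le_sum_mul_of_antitone
    (fun j => comonotoneCoupling (f · q') (g · q') k j / f k q')
    (fun j => comonotoneCoupling (f · q) (g · q) k j / f k q) (fun j => -φ j) hφ.neg ?_ ?_
  · simpa [Finset.sum_neg_distrib] using this
  · intro κ
    rw [← Finset.sum_div, ← Finset.sum_div, sum_le_comonotoneCoupling (fun k => (hf k _).le),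
      sum_le_comonotoneCoupling (fun k => (hf k _).le), cumul_eq_zero_add (f · q) k 1,
      cumul_eq_zero_add (f · q') k 1]
    apply div_le_min_sub_min (hf _ _) (hf _ _)
    intro t ht h
    rw [← cumul_eq_zero_add (f · q') k t]
    rw [← cumul_eq_zero_add (f · q) k t] at h
    exact hsc q q' hq k t ht κ 1 (by simp) h
  · rw [← Finset.sum_div, ← Finset.sum_div,
      sum_comonotoneCoupling (fun k => (hf k _).le) (hfg q).symm,
      sum_comonotoneCoupling (fun k => (hf k _).le) (hfg q').symm, div_self (hf _ _).ne',
      div_self (hf _ _).ne']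

theorem hybridCost_succ_le (hΨ : IsMLRSupport Ψ P) (hf : ∀ k i, 0 < f k i)
    (hg : ∀ j i, 0 < g j i) (hfg : ∀ i, ∑ j, g j i = ∑ k, f k i)
    (hfm : ∀ k k', k ≤ k' → MLRPLE (f k) (f k')) (hgm : ∀ j j', j ≤ j' → MLRPLE (g j) (g j'))
    (hsc : IsSingleCrossing f g) {q q' : Fin n} (hq : ∀ i, i < q' ↔ i ≤ q) :
    hybridCost Ψ f g q' ≤ hybridCost Ψ f g q := by
  have hqq : q < q' := (hq q).2 le_rfl
  have hsplit : ∀ F : Fin n → ℝ, ∑ i, F i =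
      ∑ i ∈ Finset.Iic q, F i + ∑ i ∈ Finset.Ici q', F i := by
    intro F
    rw [← Finset.sum_union]
    · congr 1
      ext i
      have := hq i
      simp only [Finset.mem_univ, Finset.mem_union, Finset.mem_Iic, Finset.mem_Ici, true_iff]
      rw [← this]
      exact lt_or_ge i q'
    · rw [Finset.disjoint_left]
      intro i hi hi'
      rw [Finset.mem_Iic, ← hq] at hi
      exact absurd (Finset.mem_Ici.1 hi') (not_le.2 hi)
  set b : J → K → Fin n → ℝ := fun j k => hybrid q' (g j) (f k) with hb
  have hbpos : ∀ j k i, 0 < b j k i := fun j k => hybrid_pos q' (hg j) (hf k)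
  -- The gradient is always taken at the hybrid for `q'`: it is exact there by Euler's identity and
  -- a lower bound at the hybrid for `q`. The same `L` and `U` thus serve both states; only the
  -- normalizations and the coupling change.
  set L : J → K → ℝ := fun j k => ∑ i ∈ Finset.Iic q, P i (b j k) * g j i with hL
  set U : J → K → ℝ := fun j k => ∑ i ∈ Finset.Ici q', P i (b j k) * f k i with hU
  have hblow : ∀ j k, ∀ i ∈ Finset.Iic q, b j k i = g j i / g j q' := fun j k i hi =>
    hybrid_of_le q' (hg j) (hf k) ((Finset.mem_Iic.1 hi).trans hqq.le)
  have hbup : ∀ j k, ∀ i ∈ Finset.Ici q', b j k i = f k i / f k q' := fun j k i hi =>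
    hybrid_of_ge q' _ _ (Finset.mem_Ici.1 hi)
  have hlow : ∀ j k k', ∑ i ∈ Finset.Iic q, P i (b j k) * b j k' i = L j k / g j q' := by
    intro j k k'
    rw [hL, Finset.sum_div]
    exact Finset.sum_congr rfl fun i hi => by rw [hblow j k' i hi, mul_div_assoc]
  have hup : ∀ j j' k, ∑ i ∈ Finset.Ici q', P i (b j k) * b j' k i = U j k / f k q' := by
    intro j j' k
    rw [hU, Finset.sum_div]
    exact Finset.sum_congr rfl fun i hi => by rw [hbup j' k i hi, mul_div_assoc]
  -- On the states up to `q` the hybrid does not depend on `k`, so `hΨ.lower` pairs one fixed vector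
  -- with two gradients. Dually for `U` and `hΨ.upper`.
  have hLanti : ∀ j, Antitone (L j) := by
    intro j k k' hk
    have h := hΨ.lower q (b j k) (b j k') (hbpos j k) (hbpos j k')
      (MLRPLE.hybrid (hg j) (hg j) (hf k) (hf k') (MLRPLE.refl _) (hfm k k' hk) q')
    rw [hlow, hlow, div_le_div_iff_of_pos_right (hg j q')] at h
    exact h
  have hUmono : ∀ k, Monotone (fun j => U j k) := by
    intro k j j' hj
    have h := hΨ.upper q' (b j k) (b j' k) (hbpos j k) (hbpos j' k)
      (MLRPLE.hybrid (hg j) (hg j') (hf k) (hf k) (hgm j j' hj) (MLRPLE.refl _) q')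
    rw [hup, hup, div_le_div_iff_of_pos_right (hf k q')] at h
    exact h
  have hb_eq : ∀ j k, Ψ (b j k) = L j k / g j q' + U j k / f k q' := by
    intro j k
    rw [← hΨ.euler _ (hbpos j k), hsplit, hlow, hup]
  have ha_ge : ∀ j k, L j k / g j q + U j k / f k q ≤ Ψ (hybrid q (g j) (f k)) := by
    intro j k
    refine le_trans (le_of_eq ?_) (hΨ.support (b j k) (hybrid q (g j) (f k)) (hbpos j k)
      (hybrid_pos q (hg j) (hf k)))
    rw [hsplit, hL, hU, Finset.sum_div, Finset.sum_div]
    congr 1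
    · refine Finset.sum_congr rfl fun i hi => ?_
      rw [hybrid_of_le q (hg j) (hf k) (Finset.mem_Iic.1 hi), mul_div_assoc]
    · refine Finset.sum_congr rfl fun i hi => ?_
      rw [hybrid_of_ge q _ _ (hqq.le.trans (Finset.mem_Ici.1 hi)), mul_div_assoc]
  -- `L` is averaged over `k` given `j`, and `U` over `j` given `k`, so that each meets its own
  -- dominance lemma.
  have h1 : ∀ p : Fin n, ∑ j, ∑ k, comonotoneCoupling (g · p) (f · p) j k *
      (L j k / g j p + U j k / f k p) =
      ∑ j, ∑ k, comonotoneCoupling (g · p) (f · p) j k / g j p * L j k +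
      ∑ k, ∑ j, comonotoneCoupling (g · p) (f · p) j k / f k p * U j k := by
    intro p
    rw [Finset.sum_comm (s := (Finset.univ : Finset K)), ← Finset.sum_add_distrib]
    refine Finset.sum_congr rfl fun j _ => ?_
    rw [← Finset.sum_add_distrib]
    refine Finset.sum_congr rfl fun k _ => ?_
    ring
  calc hybridCost Ψ f g q' = ∑ j, ∑ k, comonotoneCoupling (g · q') (f · q') j k *
        (L j k / g j q' + U j k / f k q') := by
        simp only [hybridCost, ← hb_eq, hb]
    _ ≤ ∑ j, ∑ k, comonotoneCoupling (g · q) (f · q) j k * (L j k / g j q + U j k / f k q) := by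
        rw [h1, h1]
        exact add_le_add
          (Finset.sum_le_sum fun j _ =>
            sum_coupling_div_mul_antitone hg hfg hsc hqq j _ (hLanti j))
          (Finset.sum_le_sum fun k _ =>
            sum_coupling_div_mul_monotone hf hfg hsc hqq k _ (hUmono k))
    _ ≤ hybridCost Ψ f g q :=
        Finset.sum_le_sum fun j _ => Finset.sum_le_sum fun k _ =>
          mul_le_mul_of_nonneg_left (ha_ge j k)
            (comonotoneCoupling_nonneg (fun j => (hg j q).le) (fun k => (hf k q).le) j k)

/-- At the lowest state the hybrid is `f k` rescaled, and the marginal of the coupling undoes the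
rescaling. -/
theorem hybridCost_bot (hΨ : IsMLRSupport Ψ P) (hf : ∀ k i, 0 < f k i)
    (hfg : ∀ i, ∑ j, g j i = ∑ k, f k i) {q : Fin n} (hq : ∀ i, q ≤ i) :
    hybridCost Ψ f g q = ∑ k, Ψ (f k) := by
  rw [hybridCost, Finset.sum_comm]
  refine Finset.sum_congr rfl fun k _ => ?_
  have h1 : ∀ j, hybrid q (g j) (f k) = (f k q)⁻¹ • f k := by
    intro j
    ext i
    rw [hybrid_of_ge q _ _ (hq i), Pi.smul_apply, smul_eq_mul, div_eq_inv_mul]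
  simp only [h1, ← Finset.sum_mul, comonotoneCoupling_comm (fun j => g j q)]
  rw [sum_comonotoneCoupling (fun k => (hf k q).le) (hfg q).symm,
    hΨ.smul _ _ (inv_pos.2 (hf k q)) (hf k), mul_inv_cancel_left₀ (hf k q).ne']

theorem hybridCost_top (hΨ : IsMLRSupport Ψ P) (hf : ∀ k i, 0 < f k i) (hg : ∀ j i, 0 < g j i)
    (hfg : ∀ i, ∑ j, g j i = ∑ k, f k i) {q : Fin n} (hq : ∀ i, i ≤ q) :
    hybridCost Ψ f g q = ∑ j, Ψ (g j) := by
  rw [hybridCost]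
  refine Finset.sum_congr rfl fun j _ => ?_
  have h1 : ∀ k, hybrid q (g j) (f k) = (g j q)⁻¹ • g j := by
    intro k
    ext i
    rw [hybrid_of_le q (hg j) (hf k) (hq i), Pi.smul_apply, smul_eq_mul, div_eq_inv_mul]
  simp only [h1, ← Finset.sum_mul]
  rw [sum_comonotoneCoupling (fun k => (hg k q).le) (hfg q),
    hΨ.smul _ _ (inv_pos.2 (hg j q)) (hg j), mul_inv_cancel_left₀ (hg j q).ne']

end Hybrid

theorem sum_le_sum_of_isSingleCrossing {n : ℕ} {J K : Type*} [LinearOrder J] [LinearOrder K]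
    [Fintype J] [Fintype K] {f : K → Fin (n + 1) → ℝ} {g : J → Fin (n + 1) → ℝ}
    {Ψ : (Fin (n + 1) → ℝ) → ℝ} {P : Fin (n + 1) → (Fin (n + 1) → ℝ) → ℝ}
    (hΨ : IsMLRSupport Ψ P) (hf : ∀ k i, 0 < f k i)
    (hg : ∀ j i, 0 < g j i) (hfg : ∀ i, ∑ j, g j i = ∑ k, f k i)
    (hfm : ∀ k k', k ≤ k' → MLRPLE (f k) (f k')) (hgm : ∀ j j', j ≤ j' → MLRPLE (g j) (g j'))
    (hsc : IsSingleCrossing f g) : ∑ j, Ψ (g j) ≤ ∑ k, Ψ (f k) := by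
  rw [← hybridCost_bot hΨ hf hfg (q := 0) Fin.zero_le,
    ← hybridCost_top hΨ hf hg hfg (q := Fin.last n) Fin.le_last]
  generalize Fin.last n = q
  induction q using Fin.induction with
  | zero => exact le_rfl
  | succ q ih =>
    refine le_trans (hybridCost_succ_le hΨ hf hg hfg hfm hgm hsc fun i => ?_) ih
    rw [Fin.lt_def, Fin.le_def, Fin.val_succ, Fin.val_castSucc, Nat.lt_succ_iff]

/-! ### Totally positive mixing of the states -/

section Mixing

variable {n : ℕ}

/-- Variation diminishing: with `p₀` the first index where `φ` is positive, total positivity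
compares the two sums term by term after cross-multiplying by column `p₀`. If `φ` is nowhere
positive, `h` forces it to vanish. -/
theorem sum_mul_nonneg_of_totallyPositive {W : Fin n → Fin n → ℝ} (hW : ∀ i p, 0 < W i p)
    (hTP : ∀ i i', i < i' → ∀ p p', p < p' → W i' p * W i p' ≤ W i p * W i' p')
    {φ : Fin n → ℝ} (hφ : ∀ p p', p < p' → 0 < φ p → 0 ≤ φ p') {i i' : Fin n} (hi : i < i')
    (h : 0 ≤ ∑ p, W i p * φ p) : 0 ≤ ∑ p, W i' p * φ p := by
  by_cases hex : ∃ p, 0 < φ p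
  · obtain ⟨p₀, hp₀, hmin⟩ : ∃ p₀, 0 < φ p₀ ∧ ∀ p < p₀, φ p ≤ 0 := by
      obtain ⟨p₀, hp₀⟩ := WellFounded.has_min (wellFounded_lt (α := Fin n)) {p | 0 < φ p} hex
      exact ⟨p₀, hp₀.1, fun p hp => not_lt.1 fun h => hp₀.2 p h hp⟩
    have key : W i' p₀ * ∑ p, W i p * φ p ≤ W i p₀ * ∑ p, W i' p * φ p := by
      rw [Finset.mul_sum, Finset.mul_sum]
      refine Finset.sum_le_sum fun p _ => ?_
      rcases lt_trichotomy p p₀ with hp | rfl | hp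
      · have := mul_le_mul_of_nonpos_right (hTP i i' hi p p₀ hp) (hmin p hp)
        linarith
      · exact le_of_eq (by ring)
      · have := mul_le_mul_of_nonneg_right (hTP i i' hi p₀ p hp) (hφ p₀ p hp hp₀)
        linarith
    have h1 : 0 ≤ W i p₀ * ∑ p, W i' p * φ p := (mul_nonneg (hW i' p₀).le h).trans key
    exact nonneg_of_mul_nonneg_right h1 (hW i p₀)
  · push Not at hex
    have h1 : ∀ p ∈ Finset.univ, W i p * φ p ≤ 0 := fun p _ =>
      mul_nonpos_of_nonneg_of_nonpos (hW i p).le (hex p)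
    have h2 := (Finset.sum_eq_zero_iff_of_nonpos h1).1 (le_antisymm (Finset.sum_nonpos h1) h)
    refine Finset.sum_nonneg fun p hp => ?_
    rw [(mul_eq_zero.1 (h2 p hp)).resolve_left (hW i p).ne', mul_zero]

/-- As in the Cauchy–Binet formula: after symmetrizing in `p` and `q`, the difference is a sum of
products of two nonnegative minors. -/
theorem MLRPLE.mulVec {W : Matrix (Fin n) (Fin n) ℝ}
    (hTP : ∀ i i', i < i' → ∀ p p', p < p' → W i' p * W i p' ≤ W i p * W i' p')
    {a b : Fin n → ℝ} (hab : MLRPLE a b) : MLRPLE (W.mulVec a) (W.mulVec b) := by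
  intro i i' hi
  simp only [Matrix.mulVec, dotProduct, Finset.sum_mul_sum]
  have h1 : ∑ p, ∑ q, (W i p * a p) * (W i' q * b q) + ∑ p, ∑ q, (W i p * a p) * (W i' q * b q) =
      ∑ p, ∑ q, (W i p * W i' q * (a p * b q) + W i q * W i' p * (a q * b p)) := by
    conv_lhs => arg 2; rw [Finset.sum_comm]
    rw [← Finset.sum_add_distrib]
    refine Finset.sum_congr rfl fun p _ => ?_
    rw [← Finset.sum_add_distrib]
    exact Finset.sum_congr rfl fun q _ => by ring
  have h2 : ∑ p, ∑ q, (W i' p * a p) * (W i q * b q) + ∑ p, ∑ q, (W i' p * a p) * (W i q * b q) =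
      ∑ p, ∑ q, (W i' p * W i q * (a p * b q) + W i' q * W i p * (a q * b p)) := by
    conv_lhs => arg 2; rw [Finset.sum_comm]
    rw [← Finset.sum_add_distrib]
    refine Finset.sum_congr rfl fun p _ => ?_
    rw [← Finset.sum_add_distrib]
    exact Finset.sum_congr rfl fun q _ => by ring
  have h3 : ∑ p, ∑ q, (W i' p * W i q * (a p * b q) + W i' q * W i p * (a q * b p)) ≤
      ∑ p, ∑ q, (W i p * W i' q * (a p * b q) + W i q * W i' p * (a q * b p)) := by
    refine Finset.sum_le_sum fun p _ => Finset.sum_le_sum fun q _ => ?_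
    rcases lt_trichotomy p q with h | rfl | h
    · have := mul_nonneg (sub_nonneg.2 (hTP i i' hi p q h)) (sub_nonneg.2 (hab p q h))
      linarith
    · exact le_of_eq (by ring)
    · have := mul_nonneg (sub_nonneg.2 (hTP i i' hi q p h)) (sub_nonneg.2 (hab q p h))
      linarith
  linarith

theorem cumul_mulVec {K : Type*} [LinearOrder K] [Fintype K] (W : Matrix (Fin n) (Fin n) ℝ)
    (a : K → Fin n → ℝ) (i : Fin n) (k : K) (s : ℝ) :
    cumul (fun k => W.mulVec (a k) i) k s = ∑ p, W i p * cumul (a · p) k s := by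
  simp only [cumul, Matrix.mulVec, dotProduct, mul_add, Finset.mul_sum, Finset.sum_add_distrib]
  rw [Finset.sum_comm]
  congr 1
  exact Finset.sum_congr rfl fun p _ => by ring

/-- The hypothesis starts from a strict inequality and so says nothing at ties; positive mixing
upgrades it to the weak form. -/
theorem isSingleCrossing_mulVec {J K : Type*} [LinearOrder J] [LinearOrder K]
    [Fintype J] [Fintype K] {W : Matrix (Fin n) (Fin n) ℝ} (hW : ∀ i p, 0 < W i p)
    (hTP : ∀ i i', i < i' → ∀ p p', p < p' → W i' p * W i p' ≤ W i p * W i' p')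
    {f : K → Fin n → ℝ} {g : J → Fin n → ℝ}
    (hfg : ∀ i i' : Fin n, i < i' → ∀ k, ∀ s ∈ Set.Icc (0 : ℝ) 1, ∀ j, ∀ t ∈ Set.Icc (0 : ℝ) 1,
      cumul (f · i) k s < cumul (g · i) j t → cumul (f · i') k s ≤ cumul (g · i') j t) :
    IsSingleCrossing (fun k => W.mulVec (f k)) (fun j => W.mulVec (g j)) := by
  intro i i' hi k s hs j t ht h
  rw [cumul_mulVec, cumul_mulVec, ← sub_nonneg, ← Finset.sum_sub_distrib] at h ⊢
  simp only [← mul_sub] at h ⊢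
  refine sum_mul_nonneg_of_totallyPositive hW hTP (fun p p' hp h' => ?_) hi h
  exact sub_nonneg.2 (hfg p p' hp k s hs j t ht (sub_pos.1 h'))

/-- The weight `ε ^ (i - p) ^ 2`. -/
def gaussianWeight (ε : ℝ) (i p : Fin n) : ℝ := ε ^ (((i : ℤ) - (p : ℤ)).natAbs ^ 2)

/-- The stochastic matrix with entries proportional to `ε ^ (i - p) ^ 2`. -/
noncomputable def gaussianMixing (n : ℕ) (ε : ℝ) : Matrix (Fin n) (Fin n) ℝ :=
  fun i p => gaussianWeight ε i p / ∑ q, gaussianWeight ε i q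

theorem gaussianWeight_pos {ε : ℝ} (hε : 0 < ε) (i p : Fin n) : 0 < gaussianWeight ε i p :=
  pow_pos hε _

theorem gaussianWeight_sum_pos {ε : ℝ} (hε : 0 < ε) (i : Fin n) :
    0 < ∑ q, gaussianWeight ε i q :=
  Finset.sum_pos (fun q _ => gaussianWeight_pos hε i q) ⟨i, Finset.mem_univ i⟩

theorem gaussianMixing_pos {ε : ℝ} (hε : 0 < ε) (i p : Fin n) : 0 < gaussianMixing n ε i p :=
  div_pos (gaussianWeight_pos hε i p) (gaussianWeight_sum_pos hε i)

theorem gaussianMixing_row_sum {ε : ℝ} (hε : 0 < ε) (i : Fin n) :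
    ∑ p, gaussianMixing n ε i p = 1 := by
  simp only [gaussianMixing, ← Finset.sum_div]
  exact div_self (gaussianWeight_sum_pos hε i).ne'

/-- The row normalizations cancel, and the exponents differ by `2 (i' - i) (p' - p)`. -/
theorem gaussianMixing_totallyPositive {ε : ℝ} (hε : 0 < ε) (hε1 : ε ≤ 1) {i i' : Fin n}
    (hi : i < i') {p p' : Fin n} (hp : p < p') :
    gaussianMixing n ε i' p * gaussianMixing n ε i p' ≤
      gaussianMixing n ε i p * gaussianMixing n ε i' p' := by
  simp only [gaussianMixing]
  rw [div_mul_div_comm, div_mul_div_comm, mul_comm (∑ q, gaussianWeight ε i' q)]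
  apply div_le_div_of_nonneg_right _
    (mul_pos (gaussianWeight_sum_pos hε i) (gaussianWeight_sum_pos hε i')).le
  simp only [gaussianWeight, ← pow_add]
  apply pow_le_pow_of_le_one hε.le hε1
  zify
  simp only [sq_abs]
  have h1 : (i : ℤ) < i' := by exact_mod_cast hi
  have h2 : (p : ℤ) < p' := by exact_mod_cast hp
  nlinarith [mul_pos (sub_pos.2 h1) (sub_pos.2 h2)]

theorem gaussianWeight_zero (i p : Fin n) :
    gaussianWeight 0 i p = (1 : Matrix (Fin n) (Fin n) ℝ) i p := by
  unfold gaussianWeight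
  rw [Matrix.one_apply]
  split_ifs with h
  · simp [h]
  · apply zero_pow
    have : (i : ℤ) ≠ p := by exact_mod_cast fun h' => h (Fin.ext h')
    have : ((i : ℤ) - p).natAbs ≠ 0 := by omega
    exact pow_ne_zero 2 this

theorem tendsto_gaussianMixing : Filter.Tendsto (gaussianMixing n) (nhds 0) (nhds 1) := by
  have hcont : ∀ i p : Fin n, Continuous fun ε => gaussianWeight ε i p := fun i p =>
    continuous_id.pow _
  have hsum : ∀ i : Fin n, ∑ q, gaussianWeight 0 i q = 1 := by
    intro i
    simp [gaussianWeight_zero, Matrix.one_apply]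
  refine tendsto_pi_nhds.2 fun i => tendsto_pi_nhds.2 fun p => ?_
  have h := ((hcont i p).tendsto 0).div
    ((continuous_finsetSum Finset.univ fun q _ => hcont i q).tendsto 0) (by rw [hsum]; norm_num)
  rw [hsum, div_one, gaussianWeight_zero] at h
  exact h

end Mixing

/-! ### Sublinear functions on the cube and their derivatives -/

section Sublinear

variable {n : ℕ} {ψ : (Fin n → ℝ) → ℝ}

theorem mem_unitCube_iff {h : Fin n → ℝ} : h ∈ unitCube n ↔ (∀ i, 0 ≤ h i) ∧ ∀ i, h i ≤ 1 :=
  Iff.rfl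

theorem zero_mem_unitCube : (0 : Fin n → ℝ) ∈ unitCube n :=
  mem_unitCube_iff.2 ⟨fun _ => le_rfl, fun _ => zero_le_one⟩

theorem smul_mem_unitCube {h : Fin n → ℝ} (hh : h ∈ unitCube n) {γ : ℝ} (h0 : 0 ≤ γ)
    (h1 : γ ≤ 1) : γ • h ∈ unitCube n :=
  mem_unitCube_iff.2 ⟨fun i => mul_nonneg h0 (hh.1 i), fun i => mul_le_one₀ h1 (hh.1 i) (hh.2 i)⟩

theorem convex_unitCube : Convex ℝ (unitCube n) := convex_Icc 0 1

theorem SublinearOnCube.map_zero (hψ : SublinearOnCube ψ) : ψ 0 = 0 := by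
  have := hψ.1 0 zero_mem_unitCube 0 le_rfl (by simpa using zero_mem_unitCube)
  simpa using this

theorem SublinearOnCube.map_smul (hψ : SublinearOnCube ψ) {h : Fin n → ℝ} (hh : h ∈ unitCube n)
    {γ : ℝ} (h0 : 0 ≤ γ) (h1 : γ ≤ 1) : ψ (γ • h) = γ * ψ h :=
  hψ.1 h hh γ h0 (smul_mem_unitCube hh h0 h1)

theorem SublinearOnCube.map_sum_le (hψ : SublinearOnCube ψ) {ι : Type*} (s : Finset ι)
    (v : ι → Fin n → ℝ) (hv : ∀ k ∈ s, ∀ i, 0 ≤ v k i) (hs : ∑ k ∈ s, v k ∈ unitCube n) :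
    ψ (∑ k ∈ s, v k) ≤ ∑ k ∈ s, ψ (v k) := by
  classical
  induction s using Finset.induction_on with
  | empty => simp [hψ.map_zero]
  | insert a s ha ih =>
    rw [Finset.sum_insert ha] at hs ⊢
    rw [Finset.sum_insert ha]
    have hva := hv a (Finset.mem_insert_self _ _)
    have hvs : ∀ k ∈ s, ∀ i, 0 ≤ v k i := fun k hk => hv k (Finset.mem_insert_of_mem hk)
    have h0 : ∀ i, 0 ≤ (∑ k ∈ s, v k) i := fun i => by
      rw [Finset.sum_apply]
      exact Finset.sum_nonneg fun k hk => hvs k hk i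
    have hle : ∀ i, v a i + (∑ k ∈ s, v k) i ≤ 1 := hs.2
    have h1 : ∑ k ∈ s, v k ∈ unitCube n :=
      mem_unitCube_iff.2 ⟨h0, fun i => by linarith [hle i, hva i]⟩
    have h2 : v a ∈ unitCube n :=
      mem_unitCube_iff.2 ⟨hva, fun i => by linarith [hle i, h0 i]⟩
    exact (hψ.2 _ h2 _ h1 hs).trans (add_le_add le_rfl (ih hvs h1))

theorem HasDerivWithinAt.le_of_forall_le_add {φ : ℝ → ℝ} {d c : ℝ}
    (hφ : HasDerivWithinAt φ d (Set.Icc 0 1) 0) (h : ∀ t ∈ Set.Icc (0 : ℝ) 1, φ t ≤ φ 0 + t * c) :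
    d ≤ c := by
  have h1 := hasDerivWithinAt_iff_tendsto_slope.1 hφ
  have hset : Set.Icc (0 : ℝ) 1 \ {0} = Set.Ioc 0 1 := Set.Icc_sdiff_left
  rw [hset, nhdsWithin_Ioc_eq_nhdsGT (zero_lt_one (α := ℝ))] at h1
  refine le_of_tendsto h1 ?_
  filter_upwards [Ioc_mem_nhdsGT (zero_lt_one (α := ℝ))] with t ht
  rw [slope_def_field, sub_zero, div_le_iff₀ ht.1]
  linarith [h t ⟨ht.1.le, ht.2⟩]

theorem hasDerivWithinAt_segment {h a : Fin n → ℝ} (hh : h ∈ unitCube n) (ha : a ∈ unitCube n)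
    (hd : DifferentiableWithinAt ℝ ψ (unitCube n) h) :
    HasDerivWithinAt (fun t : ℝ => ψ ((1 - t) • h + t • a))
      (fderivWithin ℝ ψ (unitCube n) h (a - h)) (Set.Icc 0 1) 0 := by
  have h1 : HasDerivWithinAt (fun t : ℝ => (1 - t) • h + t • a) (a - h) (Set.Icc 0 1) 0 := by
    have h2 : HasDerivAt (fun t : ℝ => (1 - t) • h + t • a) ((-1 : ℝ) • h + (1 : ℝ) • a) 0 :=
      (((hasDerivAt_id (0 : ℝ)).const_sub 1).smul_const h).add
        ((hasDerivAt_id (0 : ℝ)).smul_const a)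
    have h3 : (-1 : ℝ) • h + (1 : ℝ) • a = a - h := by
      rw [neg_one_smul, one_smul]
      abel
    rw [h3] at h2
    exact h2.hasDerivWithinAt
  have h4 : HasFDerivWithinAt ψ (fderivWithin ℝ ψ (unitCube n) h) (unitCube n)
      ((1 - (0 : ℝ)) • h + (0 : ℝ) • a) := by
    simpa using hd.hasFDerivWithinAt
  refine h4.comp_hasDerivWithinAt 0 h1 fun t ht => ?_
  exact convex_unitCube hh ha (by linarith [ht.2]) ht.1 (by ring)

/-- Euler's identity: on the segment from `h` to the origin, which stays in the cube, `ψ` is linear.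
-/
theorem SublinearOnCube.fderivWithin_self (hψ : SublinearOnCube ψ) {h : Fin n → ℝ}
    (hh : h ∈ unitCube n) (hd : DifferentiableWithinAt ℝ ψ (unitCube n) h) :
    fderivWithin ℝ ψ (unitCube n) h h = ψ h := by
  have h1 := hasDerivWithinAt_segment hh zero_mem_unitCube hd
  have h2 : ∀ t ∈ Set.Icc (0 : ℝ) 1, ψ ((1 - t) • h + t • (0 : Fin n → ℝ)) = (1 - t) * ψ h := by
    intro t ht
    rw [smul_zero, add_zero, hψ.map_smul hh (by linarith [ht.2]) (by linarith [ht.1])]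
  have h3 := h1.le_of_forall_le_add (c := -ψ h) fun t ht => by
    rw [h2 t ht, h2 0 (by simp)]
    linarith
  have h4 := h1.neg.le_of_forall_le_add (c := ψ h) fun t ht => by
    simp only [Pi.neg_apply]
    rw [h2 t ht, h2 0 (by simp)]
    linarith
  rw [zero_sub, map_neg] at h3 h4
  linarith

/-- Convexity on the segment from `h` to `a` bounds the derivative along `a - h` by `ψ a - ψ h`;
Euler's identity removes `ψ h`. -/
theorem SublinearOnCube.fderivWithin_le (hψ : SublinearOnCube ψ) {h a : Fin n → ℝ}
    (hh : h ∈ unitCube n) (ha : a ∈ unitCube n)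
    (hd : DifferentiableWithinAt ℝ ψ (unitCube n) h) :
    fderivWithin ℝ ψ (unitCube n) h a ≤ ψ a := by
  have h1 := hasDerivWithinAt_segment hh ha hd
  have h3 := h1.le_of_forall_le_add (c := ψ a - ψ h) fun t ht => by
    have e : ψ ((1 - t) • h + t • a) ≤ (1 - t) * ψ h + t * ψ a := by
      rw [← hψ.map_smul hh (γ := 1 - t) (by linarith [ht.2]) (by linarith [ht.1]),
        ← hψ.map_smul ha ht.1 ht.2]
      exact hψ.2 _ (smul_mem_unitCube hh (by linarith [ht.2]) (by linarith [ht.1])) _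
        (smul_mem_unitCube ha ht.1 ht.2)
        (convex_unitCube hh ha (by linarith [ht.2]) ht.1 (by ring))
    simp only [sub_zero, one_smul, zero_smul, add_zero]
    linarith
  rw [map_sub, hψ.fderivWithin_self hh hd] at h3
  linarith

theorem sum_cubePartial_mul (h a : Fin n → ℝ) :
    ∑ i, cubePartial ψ i h * a i = fderivWithin ℝ ψ (unitCube n) h a := by
  conv_rhs => rw [← Finset.univ_sum_single a, map_sum]
  refine Finset.sum_congr rfl fun i _ => ?_
  have : Pi.single i (a i) = a i • (Pi.single i (1 : ℝ) : Fin n → ℝ) := by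
    rw [← Pi.single_smul, smul_eq_mul, mul_one]
  rw [this, map_smul, smul_eq_mul, cubePartial, mul_comm]

/-- The normalization of a positive vector to total mass one. -/
noncomputable def massNormalize (h : Fin n → ℝ) : Fin n → ℝ := (∑ i, h i)⁻¹ • h

theorem massNormalize_mem_unitCube {h : Fin n → ℝ} (hh : ∀ i, 0 < h i) :
    massNormalize h ∈ unitCube n := by
  refine mem_unitCube_iff.2 ⟨fun i => ?_, fun i => ?_⟩
  · exact mul_nonneg (inv_nonneg.2 (Finset.sum_nonneg fun i _ => (hh i).le)) (hh i).le
  · have h1 : h i ≤ ∑ i, h i :=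
      Finset.single_le_sum (f := h) (fun i _ => (hh i).le) (Finset.mem_univ i)
    rw [massNormalize, Pi.smul_apply, smul_eq_mul, ← div_eq_inv_mul]
    exact div_le_one_of_le₀ h1 ((hh i).le.trans h1)

/-- The positively homogeneous extension of a function on the cube. -/
noncomputable def homogeneousExtension (ψ : (Fin n → ℝ) → ℝ) (h : Fin n → ℝ) : ℝ :=
  (∑ i, h i) * ψ (massNormalize h)

end Sublinear

/-! ### Extension from the cube to the positive orthant -/

section Support

variable {n : ℕ} {ψ : (Fin (n + 1) → ℝ) → ℝ}

theorem sum_pos_of_pos {h : Fin (n + 1) → ℝ} (hh : ∀ i, 0 < h i) : 0 < ∑ i, h i :=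
  Finset.sum_pos (fun i _ => hh i) Finset.univ_nonempty

theorem sum_smul_massNormalize {h : Fin (n + 1) → ℝ} (hh : ∀ i, 0 < h i) :
    (∑ i, h i) • massNormalize h = h := by
  rw [massNormalize, smul_smul, mul_inv_cancel₀ (sum_pos_of_pos hh).ne', one_smul]

theorem massNormalize_ne_zero {h : Fin (n + 1) → ℝ} (hh : ∀ i, 0 < h i) : massNormalize h ≠ 0 := by
  intro h0
  have := congrFun (sum_smul_massNormalize hh) 0
  rw [h0, smul_zero] at this
  exact (hh 0).ne this

theorem MLRPLE.massNormalize {h h' : Fin (n + 1) → ℝ} (hh : ∀ i, 0 < h i) (hh' : ∀ i, 0 < h' i)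
    (hle : MLRPLE h h') : MLRPLE (massNormalize h) (massNormalize h') := by
  intro i i' hi
  have := mul_le_mul_of_nonneg_left (hle i i' hi)
    (mul_pos (inv_pos.2 (sum_pos_of_pos hh)) (inv_pos.2 (sum_pos_of_pos hh'))).le
  simp only [_root_.massNormalize, Pi.smul_apply, smul_eq_mul]
  linarith

theorem SublinearOnCube.homogeneousExtension_eq (hψ : SublinearOnCube ψ) {h : Fin (n + 1) → ℝ}
    (hh : ∀ i, 0 < h i) (hc : h ∈ unitCube (n + 1)) : homogeneousExtension ψ h = ψ h := by
  rw [homogeneousExtension, ← hψ.1 _ (massNormalize_mem_unitCube hh) _ (sum_pos_of_pos hh).le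
    (by rwa [sum_smul_massNormalize hh]), sum_smul_massNormalize hh]

/-- Hybrids may leave the cube, so gradients are read off at unit total mass. The hypotheses survive
because the MLR order ignores scale and each inequality is linear in the vector paired with the
gradients. -/
theorem SublinearOnCube.isMLRSupport (hψ : SublinearOnCube ψ)
    (hd : ∀ h ∈ unitCube (n + 1), h ≠ 0 → DifferentiableWithinAt ℝ ψ (unitCube (n + 1)) h)
    (hcond : ∀ l : Fin (n + 1), ∀ h ∈ unitCube (n + 1), ∀ h' ∈ unitCube (n + 1), h ≠ 0 → h' ≠ 0 →
      MLRPLE h h' →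
        ∑ i ∈ Finset.Iic l, (-cubePartial ψ i h + cubePartial ψ i h') * h i ≤ 0 ∧
        ∑ i ∈ Finset.Ici l, (-cubePartial ψ i h' + cubePartial ψ i h) * h' i ≤ 0) :
    IsMLRSupport (homogeneousExtension ψ) (fun i h => cubePartial ψ i (massNormalize h)) where
  smul c h hc hh := by
    have h1 : massNormalize (c • h) = massNormalize h := by
      simp only [massNormalize, Pi.smul_apply, smul_eq_mul, ← Finset.mul_sum]
      rw [smul_smul, mul_inv, mul_comm c⁻¹, mul_assoc, inv_mul_cancel₀ hc.ne', mul_one]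
    simp only [homogeneousExtension, h1, Pi.smul_apply, smul_eq_mul, ← Finset.mul_sum]
    ring
  euler h hh := by
    rw [sum_cubePartial_mul]
    conv_lhs => arg 2; rw [← sum_smul_massNormalize hh]
    rw [_root_.map_smul, hψ.fderivWithin_self (massNormalize_mem_unitCube hh)
      (hd _ (massNormalize_mem_unitCube hh) (massNormalize_ne_zero hh)), smul_eq_mul, homogeneousExtension]
  support h a hh ha := by
    rw [sum_cubePartial_mul]
    conv_lhs => arg 2; rw [← sum_smul_massNormalize ha]
    rw [_root_.map_smul, smul_eq_mul]
    exact mul_le_mul_of_nonneg_left (hψ.fderivWithin_le (massNormalize_mem_unitCube hh)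
      (massNormalize_mem_unitCube ha) (hd _ (massNormalize_mem_unitCube hh) (massNormalize_ne_zero hh)))
      (sum_pos_of_pos ha).le
  lower l h h' hh hh' hle := by
    have h1 := (hcond l _ (massNormalize_mem_unitCube hh) _ (massNormalize_mem_unitCube hh')
      (massNormalize_ne_zero hh) (massNormalize_ne_zero hh') (hle.massNormalize hh hh')).1
    have h2 := mul_le_mul_of_nonneg_left h1 (sum_pos_of_pos hh).le
    rw [mul_zero, Finset.mul_sum] at h2
    rw [← sub_nonpos, ← Finset.sum_sub_distrib]
    refine le_trans (le_of_eq (Finset.sum_congr rfl fun i _ => ?_)) h2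
    conv_lhs => rw [← congrFun (sum_smul_massNormalize hh) i]
    simp only [Pi.smul_apply, smul_eq_mul]
    ring
  upper l h h' hh hh' hle := by
    have h1 := (hcond l _ (massNormalize_mem_unitCube hh) _ (massNormalize_mem_unitCube hh')
      (massNormalize_ne_zero hh) (massNormalize_ne_zero hh') (hle.massNormalize hh hh')).2
    have h2 := mul_le_mul_of_nonneg_left h1 (sum_pos_of_pos hh').le
    rw [mul_zero, Finset.mul_sum] at h2
    rw [← sub_nonpos, ← Finset.sum_sub_distrib]
    refine le_trans (le_of_eq (Finset.sum_congr rfl fun i _ => ?_)) h2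
    conv_lhs => rw [← congrFun (sum_smul_massNormalize hh') i]
    simp only [Pi.smul_apply, smul_eq_mul]
    ring

end Support

/-! ### Blackwell monotonicity -/

section Blackwell

variable {n : ℕ} {C : FiniteExperiment n → ℝ≥0} {ψ : (Fin n → ℝ) → ℝ}

theorem FiniteExperiment.col_mem_unitCube (f : FiniteExperiment n) (j : Fin f.m) :
    f.col j ∈ unitCube n := by
  refine mem_unitCube_iff.2 ⟨fun i => f.stochastic.1 i j, fun i => ?_⟩
  rw [← f.stochastic.2 i]
  exact Finset.single_le_sum (f := fun j => f.mat i j) (fun j _ => f.stochastic.1 i j)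
    (Finset.mem_univ j)

theorem IsLikelihoodSeparable.cost_le_iff (hC : IsLikelihoodSeparable C ψ)
    (f g : FiniteExperiment n) : C g ≤ C f ↔ ∑ j, ψ (g.col j) ≤ ∑ j, ψ (f.col j) := by
  rw [← NNReal.coe_le_coe, hC.cost_eq, hC.cost_eq]
  exact sub_le_sub_iff_right _

theorem SublinearOnCube.blackwellMonotone (hψ : SublinearOnCube ψ)
    (hC : IsLikelihoodSeparable C ψ) : BlackwellMonotone C := by
  rintro f g ⟨M, hM, hg⟩
  rw [hC.cost_le_iff]
  have hM1 : ∀ k j, M k j ≤ 1 := fun k j => by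
    rw [← hM.2 k]
    exact Finset.single_le_sum (f := fun j => M k j) (fun j _ => hM.1 k j) (Finset.mem_univ j)
  have hcol : ∀ j, g.col j = ∑ k, M k j • f.col k := by
    intro j
    ext i
    simp only [FiniteExperiment.col, hg, Matrix.mul_apply, Finset.sum_apply, Pi.smul_apply,
      smul_eq_mul, mul_comm]
  calc ∑ j, ψ (g.col j) ≤ ∑ j, ∑ k, M k j * ψ (f.col k) := by
        refine Finset.sum_le_sum fun j _ => ?_
        have h1 := hψ.map_sum_le Finset.univ (fun k => M k j • f.col k)
          (fun k _ i => mul_nonneg (hM.1 k j) (f.stochastic.1 i k))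
          (by rw [← hcol]; exact g.col_mem_unitCube j)
        rw [← hcol] at h1
        refine h1.trans (le_of_eq (Finset.sum_congr rfl fun k _ => ?_))
        exact hψ.map_smul (f.col_mem_unitCube k) (hM.1 k j) (hM1 k j)
    _ = ∑ k, ψ (f.col k) := by
        rw [Finset.sum_comm]
        simp only [← Finset.sum_mul, hM.2, one_mul]

/-- The experiment with the likelihood vectors `u` and `1 - u`. -/
def binaryExperiment (u : Fin n → ℝ) (hu : u ∈ unitCube n) : FiniteExperiment n where
  m := 2
  two_le := le_rfl
  mat := fun i => ![u i, 1 - u i]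
  stochastic := by
    refine ⟨fun i j => ?_, fun i => by simp⟩
    fin_cases j
    · exact hu.1 i
    · exact sub_nonneg.2 (hu.2 i)

/-- The experiment with the likelihood vectors `u`, `v` and `1 - (u + v)`. -/
def ternaryExperiment (u v : Fin n → ℝ) (hu : u ∈ unitCube n) (hv : v ∈ unitCube n)
    (huv : u + v ∈ unitCube n) : FiniteExperiment n where
  m := 3
  two_le := by norm_num
  mat := fun i => ![u i, v i, 1 - (u i + v i)]
  stochastic := by
    refine ⟨fun i j => ?_, fun i => by simp [Fin.sum_univ_three]⟩
    fin_cases j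
    · exact hu.1 i
    · exact hv.1 i
    · exact sub_nonneg.2 (huv.2 i)

theorem sum_col_binaryExperiment (u : Fin n → ℝ) (hu : u ∈ unitCube n) :
    ∑ j, ψ ((binaryExperiment u hu).col j) = ψ u + ψ (1 - u) :=
  Fin.sum_univ_two (fun j : Fin 2 => ψ ((binaryExperiment u hu).col j))

theorem sum_col_ternaryExperiment (u v : Fin n → ℝ) (hu : u ∈ unitCube n) (hv : v ∈ unitCube n)
    (huv : u + v ∈ unitCube n) :
    ∑ j, ψ ((ternaryExperiment u v hu hv huv).col j) = ψ u + ψ v + ψ (1 - (u + v)) :=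
  Fin.sum_univ_three (fun j : Fin 3 => ψ ((ternaryExperiment u v hu hv huv).col j))

theorem BlackwellMonotone.map_add_le (hB : BlackwellMonotone C) (hC : IsLikelihoodSeparable C ψ)
    {u v : Fin n → ℝ} (hu : u ∈ unitCube n) (hv : v ∈ unitCube n) (huv : u + v ∈ unitCube n) :
    ψ (u + v) ≤ ψ u + ψ v := by
  have hM : IsStochasticMatrix !![(1 : ℝ), 0; 1, 0; 0, 1] := by
    refine ⟨fun i j => ?_, fun i => ?_⟩
    · fin_cases i <;> fin_cases j <;> simp
    · fin_cases i <;> simp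
  have hmul : Matrix.of (fun i => ![u i + v i, 1 - (u i + v i)]) =
      Matrix.of (fun i => ![u i, v i, 1 - (u i + v i)]) *
        !![(1 : ℝ), 0; 1, 0; 0, 1] := by
    ext i j
    rw [Matrix.mul_apply, Fin.sum_univ_three]
    fin_cases j <;> simp
  have h := (hC.cost_le_iff _ _).1 (hB (ternaryExperiment u v hu hv huv)
    (binaryExperiment (u + v) huv) ⟨_, hM, hmul⟩)
  rw [sum_col_binaryExperiment, sum_col_ternaryExperiment] at h
  linarith

/-- Randomizing over two labels for one signal is itself a garbling, so the inequality from merging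
also holds in reverse. -/
theorem BlackwellMonotone.map_split (hB : BlackwellMonotone C) (hC : IsLikelihoodSeparable C ψ)
    {h : Fin n → ℝ} (hh : h ∈ unitCube n) {s : ℝ} (hs : s ∈ Set.Icc (0 : ℝ) 1) :
    ψ (s • h) + ψ ((1 - s) • h) = ψ h := by
  have hu := smul_mem_unitCube hh hs.1 hs.2
  have hv := smul_mem_unitCube hh (sub_nonneg.2 hs.2) (sub_le_self 1 hs.1)
  have huv : s • h + (1 - s) • h = h := by rw [← add_smul, add_sub_cancel, one_smul]
  have huv' : s • h + (1 - s) • h ∈ unitCube n := by rwa [huv]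
  have hle := hB.map_add_le hC hu hv huv'
  rw [huv] at hle
  refine le_antisymm ?_ hle
  have hM : IsStochasticMatrix !![s, 1 - s, 0; 0, 0, 1] := by
    refine ⟨fun i j => ?_, fun i => ?_⟩
    · fin_cases i <;> fin_cases j <;> simp [hs.1, hs.2]
    · fin_cases i <;> simp [Fin.sum_univ_three]
  have hmul : Matrix.of (fun i => ![s * h i, (1 - s) * h i, 1 - (s * h i + (1 - s) * h i)]) =
      Matrix.of (fun i => ![h i, 1 - h i]) *
        !![s, 1 - s, 0; 0, 0, 1] := by
    ext i j
    rw [Matrix.mul_apply, Fin.sum_univ_two]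
    fin_cases j
    · simp [mul_comm]
    · simp [mul_comm]
    · simp
      ring
  have h := (hC.cost_le_iff _ _).1 (hB (binaryExperiment h hh)
    (ternaryExperiment (s • h) ((1 - s) • h) hu hv huv') ⟨_, hM, hmul⟩)
  rw [sum_col_binaryExperiment, sum_col_ternaryExperiment, huv] at h
  linarith

/-- Doubling halves any bound on `[0, 1/2]`, and reflection carries the better bound to `[1/2, 1]`;
iterate. No continuity is needed. -/
theorem eq_zero_of_doubling_of_reflection {e : ℝ → ℝ} {B : ℝ}
    (hB : ∀ x ∈ Set.Icc (0 : ℝ) 1, |e x| ≤ B)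
    (hdouble : ∀ x ∈ Set.Icc (0 : ℝ) (1 / 2), e (2 * x) = 2 * e x)
    (hrefl : ∀ x ∈ Set.Icc (0 : ℝ) 1, e (1 - x) = -e x) :
    ∀ x ∈ Set.Icc (0 : ℝ) 1, e x = 0 := by
  have key : ∀ k : ℕ, ∀ x ∈ Set.Icc (0 : ℝ) 1, |e x| ≤ B * (1 / 2) ^ k := by
    intro k
    induction k with
    | zero => simpa using hB
    | succ k ih =>
      have hhalf : ∀ x ∈ Set.Icc (0 : ℝ) (1 / 2), |e x| ≤ B * (1 / 2) ^ (k + 1) := by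
        intro x hx
        have h1 := ih (2 * x) ⟨by linarith [hx.1], by linarith [hx.2]⟩
        rw [hdouble x hx, abs_mul, abs_of_pos (two_pos (α := ℝ))] at h1
        rw [pow_succ]
        linarith
      intro x hx
      rcases le_total x (1 / 2) with h | h
      · exact hhalf x ⟨hx.1, h⟩
      · have := hhalf (1 - x) ⟨by linarith [hx.2], by linarith⟩
        rwa [hrefl x hx, abs_neg] at this
  intro x hx
  have hlim : Filter.Tendsto (fun k : ℕ => B * (1 / 2 : ℝ) ^ k) Filter.atTop (nhds (B * 0)) :=
    (tendsto_pow_atTop_nhds_zero_of_lt_one (by norm_num) (by norm_num)).const_mul B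
  rw [mul_zero] at hlim
  exact abs_nonpos_iff.1 (ge_of_tendsto' hlim fun k => key k x hx)

theorem BlackwellMonotone.map_smul_of_le_one (hB : BlackwellMonotone C)
    (hC : IsLikelihoodSeparable C ψ) {h : Fin n → ℝ} (hh : h ∈ unitCube n) {γ : ℝ}
    (hγ : γ ∈ Set.Icc (0 : ℝ) 1) : ψ (γ • h) = γ * ψ h := by
  have hmem : ∀ x ∈ Set.Icc (0 : ℝ) 1, x • h ∈ unitCube n := fun x hx =>
    smul_mem_unitCube hh hx.1 hx.2
  have hrefl : ∀ x ∈ Set.Icc (0 : ℝ) 1, ψ (x • h) + ψ ((1 - x) • h) = ψ h := fun x hx =>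
    hB.map_split hC hh hx
  have := eq_zero_of_doubling_of_reflection (e := fun x => ψ (x • h) - x * ψ h) (B := ψ h)
    ?_ ?_ ?_ γ hγ
  · exact sub_eq_zero.1 this
  · intro x hx
    -- Nonnegativity of both pieces confines `ψ (x • h)` to `[0, ψ h]`, which gives the bound `B = ψ
    -- h`.
    have h1 := hC.nonneg _ (hmem x hx)
    have h2 := hC.nonneg _ (hmem (1 - x) ⟨by linarith [hx.2], by linarith [hx.1]⟩)
    have h3 := hrefl x hx
    have h4 := hC.nonneg _ hh
    have h5 := mul_nonneg hx.1 h4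
    have h6 := mul_le_mul_of_nonneg_right hx.2 h4
    rw [abs_le]
    constructor <;> linarith
  · intro x hx
    have h1 := hB.map_split hC (hmem (2 * x) ⟨by linarith [hx.1], by linarith [hx.2]⟩)
      (s := 1 / 2) (by norm_num)
    rw [smul_smul, smul_smul, show (1 / 2 : ℝ) * (2 * x) = x by ring,
      show (1 - 1 / 2 : ℝ) * (2 * x) = x by ring] at h1
    linarith
  · intro x hx
    linarith [hrefl x hx]

theorem BlackwellMonotone.sublinearOnCube (hB : BlackwellMonotone C)
    (hC : IsLikelihoodSeparable C ψ) : SublinearOnCube ψ := by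
  refine ⟨fun h hh γ hγ hγh => ?_, fun h hh h' hh' hadd => hB.map_add_le hC hh hh' hadd⟩
  rcases le_total γ 1 with h1 | h1
  · exact hB.map_smul_of_le_one hC hh ⟨hγ, h1⟩
  · have hpos : 0 < γ := by linarith
    have := hB.map_smul_of_le_one hC hγh (γ := γ⁻¹) ⟨inv_nonneg.2 hγ, inv_le_one_of_one_le₀ h1⟩
    rw [smul_smul, inv_mul_cancel₀ hpos.ne', one_smul] at this
    rw [this, mul_inv_cancel_left₀ hpos.ne']

end Blackwell

/-! ### From Lehmann's order to crossing of cumulative masses -/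

namespace FiniteExperiment

variable {n : ℕ}

/-- The signals that have positive probability in some state. -/
abbrev NonzeroSignal (f : FiniteExperiment n) : Type := {j : Fin f.m // f.col j ≠ 0}

noncomputable instance (f : FiniteExperiment n) : Fintype f.NonzeroSignal := Fintype.ofFinite _

theorem sum_nonzeroSignal (f : FiniteExperiment n) (F : Fin f.m → ℝ)
    (hF : ∀ j, f.col j = 0 → F j = 0) : ∑ k : f.NonzeroSignal, F k = ∑ j, F j := by
  classical
  rw [← Finset.sum_subtype (Finset.univ.filter fun j => f.col j ≠ 0) (by simp) F,
    Finset.sum_filter]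
  refine Finset.sum_congr rfl fun j _ => ?_
  split_ifs with h
  · rfl
  · exact (hF j (not_not.1 h)).symm

theorem cumul_nonzeroSignal (f : FiniteExperiment n) (i : Fin n) (k : f.NonzeroSignal) (s : ℝ) :
    cumul (fun k : f.NonzeroSignal => f.col k i) k s = cumul (fun j => f.col j i) (k : Fin f.m) s := by
  unfold cumul
  congr 1
  rw [Finset.sum_filter, Finset.sum_filter]
  exact f.sum_nonzeroSignal (fun j => if j < (k : Fin f.m) then f.col j i else 0) fun j hj => by
    simp [hj]

theorem cdf_add_eq_cumul (f : FiniteExperiment n) (i : Fin n) (k : Fin f.m) {s : ℝ}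
    (hs : s ∈ Set.Icc (0 : ℝ) 1) : f.cdf i ((k : ℝ) + s) = cumul (fun j => f.col j i) k s := by
  have h1 : s * f.col k i = ∑ j, if j = k then s * f.col j i else 0 := by simp
  rw [cdf, cumul, Finset.sum_filter, h1, ← Finset.sum_add_distrib]
  refine Finset.sum_congr rfl fun j _ => ?_
  rcases lt_trichotomy j k with h | rfl | h
  · have h2 : (j : ℝ) + 1 ≤ k := by exact_mod_cast h
    rw [if_pos h, if_neg h.ne, min_eq_left (by linarith [hs.1]), max_eq_right zero_le_one]
    simp [col]
  · rw [if_neg (lt_irrefl _), if_pos rfl, add_sub_cancel_left, min_eq_right hs.2,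
      max_eq_right hs.1, zero_add, mul_comm, col]
  · have h2 : (k : ℝ) + 1 ≤ j := by exact_mod_cast h
    rw [if_neg h.not_gt, if_neg h.ne', min_eq_right (by linarith [hs.2]),
      max_eq_left (by linarith [hs.2])]
    simp

theorem cdf_mono (f : FiniteExperiment n) (i : Fin n) : Monotone (f.cdf i) := by
  intro x y hxy
  refine Finset.sum_le_sum fun j _ => mul_le_mul_of_nonneg_left ?_ (f.stochastic.1 i j)
  exact max_le_max le_rfl (min_le_min le_rfl (by linarith))

/-- Strictness places `x` below the selected inverse `z i`, hence below `z i'`. Equality would not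
suffice, since `f.cdf i` may be flat. -/
theorem LehmannGE.cdf_le {f g : FiniteExperiment n} (h : f.LehmannGE g) {y : ℝ}
    (hy : y ∈ Set.Icc (0 : ℝ) g.m) {x : ℝ} {i i' : Fin n} (hi : i < i')
    (hlt : f.cdf i x < g.cdf i y) : f.cdf i' x ≤ g.cdf i' y := by
  obtain ⟨z, hz, hzy⟩ := h y hy
  rw [← (hzy i).2] at hlt
  rw [← (hzy i').2]
  exact f.cdf_mono i' (((f.cdf_mono i).reflect_lt hlt).le.trans (hz hi.le))

theorem LehmannGE.cumul_le {f g : FiniteExperiment n} (h : f.LehmannGE g) {i i' : Fin n}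
    (hi : i < i') (k : f.NonzeroSignal) {s : ℝ} (hs : s ∈ Set.Icc (0 : ℝ) 1) (j : g.NonzeroSignal)
    {t : ℝ} (ht : t ∈ Set.Icc (0 : ℝ) 1)
    (hlt : cumul (fun k : f.NonzeroSignal => f.col k i) k s <
      cumul (fun j : g.NonzeroSignal => g.col j i) j t) :
    cumul (fun k : f.NonzeroSignal => f.col k i') k s ≤
      cumul (fun j : g.NonzeroSignal => g.col j i') j t := by
  simp only [cumul_nonzeroSignal, ← cdf_add_eq_cumul _ _ _ hs, ← cdf_add_eq_cumul _ _ _ ht]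
    at hlt ⊢
  refine h.cdf_le ⟨by have := ht.1; positivity, ?_⟩ hi hlt
  have : ((j : Fin g.m) : ℝ) + 1 ≤ g.m := by exact_mod_cast (j : Fin g.m).isLt
  linarith [ht.2]

theorem MLRP.mlrple_col {f : FiniteExperiment n} (hf : f.MLRP) {j j' : Fin f.m} (hj : j ≤ j') :
    MLRPLE (f.col j) (f.col j') := by
  rcases hj.eq_or_lt with rfl | hj
  · exact MLRPLE.refl _
  · exact fun i i' hi => hf i i' hi j j' hj

end FiniteExperiment

/-! ### Lehmann monotonicity by approximation -/

section Lehmann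

variable {n : ℕ}

theorem mulVec_mem_unitCube {W : Matrix (Fin n) (Fin n) ℝ} (hW : ∀ i p, 0 ≤ W i p)
    (hrow : ∀ i, ∑ p, W i p = 1) {h : Fin n → ℝ} (hh : h ∈ unitCube n) :
    W.mulVec h ∈ unitCube n := by
  refine mem_unitCube_iff.2 ⟨fun i => ?_, fun i => ?_⟩
  · rw [Matrix.mulVec, dotProduct]
    exact Finset.sum_nonneg fun p _ => mul_nonneg (hW i p) (hh.1 p)
  · rw [← hrow i, Matrix.mulVec, dotProduct]
    exact Finset.sum_le_sum fun p _ => mul_le_of_le_one_right (hW i p) (hh.2 p)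

theorem mulVec_pos {W : Matrix (Fin n) (Fin n) ℝ} (hW : ∀ i p, 0 < W i p) {h : Fin n → ℝ}
    (hh : h ∈ unitCube n) (h0 : h ≠ 0) (i : Fin n) : 0 < W.mulVec h i := by
  obtain ⟨p, hp⟩ := Function.ne_iff.1 h0
  exact Finset.sum_pos' (fun p _ => mul_nonneg (hW i p).le (hh.1 p))
    ⟨p, Finset.mem_univ p, mul_pos (hW i p) (lt_of_le_of_ne (hh.1 p) (Ne.symm hp))⟩

theorem FiniteExperiment.sum_mulVec_col (f : FiniteExperiment n) {W : Matrix (Fin n) (Fin n) ℝ}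
    (hrow : ∀ i, ∑ p, W i p = 1) (i : Fin n) :
    ∑ k : f.NonzeroSignal, W.mulVec (f.col k) i = 1 := by
  rw [f.sum_nonzeroSignal (fun j => W.mulVec (f.col j) i) fun j hj => by simp [hj]]
  simp only [Matrix.mulVec, dotProduct]
  rw [Finset.sum_comm, ← hrow i]
  refine Finset.sum_congr rfl fun p _ => ?_
  rw [← Finset.mul_sum]
  exact (congrArg (W i p * ·) (f.stochastic.2 p)).trans (mul_one _)

theorem sum_mulVec_le_of_lehmannGE {ψ : (Fin (n + 1) → ℝ) → ℝ}
    {P : Fin (n + 1) → (Fin (n + 1) → ℝ) → ℝ} (hψ : SublinearOnCube ψ)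
    (hP : IsMLRSupport (homogeneousExtension ψ) P) {f g : FiniteExperiment (n + 1)}
    (hf : f.MLRP) (hg : g.MLRP) (hfg : f.LehmannGE g) {ε : ℝ} (hε : 0 < ε) (hε1 : ε ≤ 1) :
    ∑ j : g.NonzeroSignal, ψ ((gaussianMixing (n + 1) ε).mulVec (g.col j)) ≤
      ∑ k : f.NonzeroSignal, ψ ((gaussianMixing (n + 1) ε).mulVec (f.col k)) := by
  set W := gaussianMixing (n + 1) ε
  have hW : ∀ i p, 0 < W i p := gaussianMixing_pos hε
  have hrow : ∀ i, ∑ p, W i p = 1 := gaussianMixing_row_sum hε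
  have hTP : ∀ i i', i < i' → ∀ p p', p < p' → W i' p * W i p' ≤ W i p * W i' p' :=
    fun i i' hi p p' hp => gaussianMixing_totallyPositive hε hε1 hi hp
  have hpos : ∀ (e : FiniteExperiment (n + 1)) (k : e.NonzeroSignal) (i : Fin (n + 1)),
      0 < W.mulVec (e.col k) i := fun e k i => mulVec_pos hW (e.col_mem_unitCube k) k.2 i
  have hext : ∀ (e : FiniteExperiment (n + 1)) (k : e.NonzeroSignal),
      homogeneousExtension ψ (W.mulVec (e.col k)) = ψ (W.mulVec (e.col k)) := fun e k =>
    hψ.homogeneousExtension_eq (hpos e k)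
      (mulVec_mem_unitCube (fun i p => (hW i p).le) hrow (e.col_mem_unitCube k))
  simp only [← hext]
  exact sum_le_sum_of_isSingleCrossing hP (hpos f) (hpos g)
    (fun i => by rw [f.sum_mulVec_col hrow, g.sum_mulVec_col hrow])
    (fun k k' hk => (hf.mlrple_col hk).mulVec hTP) (fun j j' hj => (hg.mlrple_col hj).mulVec hTP)
    (isSingleCrossing_mulVec hW hTP fun i i' hi k s hs j t ht => hfg.cumul_le hi k hs j ht)

/-- Only nonzero signals enter, because continuity of `ψ` at the origin is not available. -/
theorem tendsto_sum_mulVec {ψ : (Fin n → ℝ) → ℝ}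
    (hd : ∀ h ∈ unitCube n, h ≠ 0 → DifferentiableWithinAt ℝ ψ (unitCube n) h)
    (f : FiniteExperiment n) : Filter.Tendsto
      (fun ε => ∑ k : f.NonzeroSignal, ψ ((gaussianMixing n ε).mulVec (f.col k)))
      (nhdsWithin 0 (Set.Ioi 0)) (nhds (∑ k : f.NonzeroSignal, ψ (f.col k))) := by
  refine tendsto_finsetSum _ fun k _ => ?_
  have hk := f.col_mem_unitCube k
  have h1 : Filter.Tendsto (fun ε => (gaussianMixing n ε).mulVec (f.col k))
      (nhdsWithin 0 (Set.Ioi 0)) (nhds (f.col k)) := by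
    have h2 : Continuous fun W : Matrix (Fin n) (Fin n) ℝ => W.mulVec (f.col k) := by fun_prop
    have h3 := (h2.tendsto 1).comp (tendsto_gaussianMixing (n := n))
    rw [Matrix.one_mulVec] at h3
    exact h3.mono_left nhdsWithin_le_nhds
  refine (hd _ hk k.2).continuousWithinAt.tendsto.comp
    (tendsto_nhdsWithin_iff.2 ⟨h1, ?_⟩)
  filter_upwards [self_mem_nhdsWithin] with ε hε
  exact mulVec_mem_unitCube (fun i p => (gaussianMixing_pos hε i p).le)
    (gaussianMixing_row_sum hε) hk

theorem SublinearOnCube.lehmannMonotone {C : FiniteExperiment n → ℝ≥0} {ψ : (Fin n → ℝ) → ℝ}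
    (hψ : SublinearOnCube ψ) (hC : IsLikelihoodSeparable C ψ)
    (hcond : ∀ l : Fin n, ∀ h ∈ unitCube n, ∀ h' ∈ unitCube n, h ≠ 0 → h' ≠ 0 → MLRPLE h h' →
      ∑ i ∈ Finset.Iic l, (-cubePartial ψ i h + cubePartial ψ i h') * h i ≤ 0 ∧
      ∑ i ∈ Finset.Ici l, (-cubePartial ψ i h' + cubePartial ψ i h) * h' i ≤ 0) :
    LehmannMonotone C := by
  intro f g hf hg hfg
  have hzero : ∀ e : FiniteExperiment n, ∑ k : e.NonzeroSignal, ψ (e.col k) = ∑ j, ψ (e.col j) :=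
    fun e => e.sum_nonzeroSignal (fun j => ψ (e.col j)) fun j hj => by rw [hj, hψ.map_zero]
  rw [hC.cost_le_iff]
  cases n with
  | zero =>
    -- Without states, the only likelihood vector is the origin.
    have h0 : ∀ h, ψ h = 0 := fun h => by rw [Subsingleton.elim h 0, hψ.map_zero]
    simp [h0]
  | succ n =>
    rw [← hzero, ← hzero]
    have hP := hψ.isMLRSupport hC.differentiable hcond
    refine le_of_tendsto_of_tendsto (tendsto_sum_mulVec hC.differentiable g)
      (tendsto_sum_mulVec hC.differentiable f) ?_
    filter_upwards [Ioc_mem_nhdsGT (zero_lt_one (α := ℝ))] with ε hε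
    exact sum_mulVec_le_of_lehmannGE hψ hP hf hg hfg hε.1 hε.2

end Lehmann

theorem mainTheorem5 (n : ℕ) (C : FiniteExperiment n → ℝ≥0) (ψ : (Fin n → ℝ) → ℝ)
    (hC : IsLikelihoodSeparable C ψ) :
    (BlackwellMonotone C ↔ SublinearOnCube ψ) ∧
    (SublinearOnCube ψ →
      (∀ l : Fin n, ∀ h ∈ unitCube n, ∀ h' ∈ unitCube n, h ≠ 0 → h' ≠ 0 → MLRPLE h h' →
        ∑ i ∈ Finset.Iic l, (-cubePartial ψ i h + cubePartial ψ i h') * h i ≤ 0 ∧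
        ∑ i ∈ Finset.Ici l, (-cubePartial ψ i h' + cubePartial ψ i h) * h' i ≤ 0) →
      LehmannMonotone C) :=
  ⟨⟨fun hB => hB.sublinearOnCube hC, fun hψ => hψ.blackwellMonotone hC⟩,
    fun hψ hcond => hψ.lehmannMonotone hC hcond⟩
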